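/- Let $k\in\mathbb R$, let $r,m\ge 0$ be integers, and let $\mathcal O_{k+1}$ be the domain of holomorphic functions on the half plane $\operatorname{Re} z>k+1$. Let $\mathcal D_k$ be the set of arithmetic functions $\alpha:\{1,2,3,\dots\}\to\mathbb C$ such that for every $\varepsilon>0$ there is $C>0$ with $|\alpha(n)|\le C n^{k+\varepsilon}$ for all $n\ge 1$. For $\alpha\in\mathcal D_k$ let $F(\alpha)(z)=\sum_{n\ge 1}\alpha(n)n^{-z}\in\mathcal O_{k+1}$ be its Dirichlet series and $F^{(i)}(\alpha)\in\mathcal O_{k+1}$ its $i$-th derivative. Call two multiplicative functions $\alpha,\beta$ equivalent if, for all but finitely many primes $p$, $\alpha(p^j)=\beta(p^j)$ for all integers $j\ge 1$. Let $e$ be the function with $e(1)=1$ and $e(n)=0$ for $n\ge 2$. Let $$\mathcal B_{k+1}=\{f\in\mathcal O_{k+1}:\ \lim_{x\to+\infty}e^{-ax}|f(x)|=0\ \text{for all } a>0\},$$ $$\mathcal I_{k+1}=\{f\in\mathcal O_{k+1}:\ \lim_{x\to+\infty}e^{ax}|f(x)|=0\ \text{for some } a>0\},$$ the limits being taken along the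 real line. Let $\mathcal A_{k+1}$ be any $\mathbb C$-subalgebra of $\mathcal O_{k+1}$ contained in $(\mathcal B_{k+1}\setminus\mathcal I_{k+1})\cup\{0\}$, and let $\mathcal F_{k+1}$ be its field of fractions, a subfield of the field of fractions of $\mathcal O_{k+1}$. Let $\alpha_1,\dots,\alpha_r\in\mathcal D_k$ be multiplicative functions (so $\alpha_j(1)=1$) such that $e,\alpha_1,\dots,\alpha_r$ are pairwise non-equivalent. Then the functions $F^{(i)}(\alpha_j)$, $0\le i\le m$, $1\le j\le r$, are linearly independent over $\mathcal F_{k+1}$. In particular, they are linearly independent over the field of meromorphic functions of order $<1$, that is, the field of quotients $f/g$ of entire functions $f,g$ ($g\ne 0$) of order of growth $<1$; here the order of growth of an entire function $f$ is the infimum of the $\rho>0$ for which there are $A,B>0$ with $|f(z)|\le Ae^{B|z|^\rho}$ for all $z\in\mathbb C$. -/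

import Mathlib

open Filter Topology

noncomputable section

namespace DirichletIndep

/-- The open half plane `Re z > k`. -/
abbrev HalfPlane (k : ℝ) : Type := {z : ℂ // k < z.re}

/-- The `ℂ`-algebra `𝒪_k` of holomorphic functions on the half plane `Re z > k`. -/
def Hol (k : ℝ) : Subalgebra ℂ (HalfPlane k → ℂ) where
  carrier := {f | ∃ g : ℂ → ℂ, DifferentiableOn ℂ g {z | k < z.re} ∧ ∀ z, f z = g z}
  mul_mem' := by
    rintro f₁ f₂ ⟨g₁, h₁, e₁⟩ ⟨g₂, h₂, e₂⟩
    exact ⟨g₁ * g₂, h₁.mul h₂, fun z => by simp [e₁, e₂]⟩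
  add_mem' := by
    rintro f₁ f₂ ⟨g₁, h₁, e₁⟩ ⟨g₂, h₂, e₂⟩
    exact ⟨g₁ + g₂, h₁.add h₂, fun z => by simp [e₁, e₂]⟩
  algebraMap_mem' c := ⟨fun _ => c, differentiableOn_const c, fun _ => rfl⟩

/-- `𝒪_k` is an integral domain, so that its fraction ring, the field of meromorphic functions
on `Re z > k`, is a field. -/
instance Hol.instIsDomain (k : ℝ) : IsDomain (Hol k) := by
  have hopen : IsOpen {z : ℂ | k < z.re} := isOpen_lt continuous_const Complex.continuous_re
  have : Nontrivial (Hol k) := by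
    refine ⟨0, 1, fun h => ?_⟩
    have := congrFun (congrArg Subtype.val h) ⟨((k + 1 : ℝ) : ℂ), by simp⟩
    simp at this
  have : NoZeroDivisors (Hol k) := by
    refine ⟨?_⟩
    rintro ⟨f₁, g₁, h₁, e₁⟩ ⟨f₂, g₂, h₂, e₂⟩ h
    have hz : ∀ z ∈ {z : ℂ | k < z.re}, (g₁ * g₂) z = 0 := by
      intro z hz
      have := congrFun (congrArg Subtype.val h) ⟨z, hz⟩
      simpa [e₁, e₂] using this
    have hc : IsPreconnected {z : ℂ | k < z.re} := (convex_halfSpace_re_gt k).isPreconnected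
    rcases (h₁.analyticOnNhd hopen).eq_zero_or_eq_zero_of_mul_eq_zero
      (h₂.analyticOnNhd hopen) (fun z hz' => hz z hz') hc with h0 | h0
    · left
      ext z
      simpa [e₁] using h0 z z.2
    · right
      ext z
      simpa [e₂] using h0 z z.2
  exact NoZeroDivisors.to_isDomain _

/-- The field of meromorphic functions on `Re z > k`: the field of fractions of `𝒪_k`. -/
def Mer (k : ℝ) : Type := FractionRing (Hol k)

instance Mer.instField (k : ℝ) : Field (Mer k) := inferInstanceAs (Field (FractionRing (Hol k)))

instance Mer.instAlgebra (k : ℝ) : Algebra (Hol k) (Mer k) :=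
  inferInstanceAs (Algebra (Hol k) (FractionRing (Hol k)))

instance Mer.instIsFractionRing (k : ℝ) : IsFractionRing (Hol k) (Mer k) :=
  inferInstanceAs (IsFractionRing (Hol k) (FractionRing (Hol k)))

/-- The value at a real point `x > k` of a function on the half plane `Re z > k`. -/
def evalReal {k : ℝ} (f : Hol k) (x : Set.Ioi k) : ℂ := f.1 ⟨((x : ℝ) : ℂ), x.2⟩

/-- `ℬ_k`: the functions `f ∈ 𝒪_k` such that `e^{-ax} |f(x)| → 0` as `x → +∞`
for every `a > 0`. -/
def subexp (k : ℝ) : Set (Hol k) :=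
  {f | ∀ a : ℝ, 0 < a →
    Tendsto (fun x : Set.Ioi k => Real.exp (-a * x) * ‖evalReal f x‖) atTop (𝓝 0)}

/-- `ℐ_k`: the functions `f ∈ 𝒪_k` such that `e^{ax} |f(x)| → 0` as `x → +∞`
for some `a > 0`. -/
def expDecay (k : ℝ) : Set (Hol k) :=
  {f | ∃ a : ℝ, 0 < a ∧
    Tendsto (fun x : Set.Ioi k => Real.exp (a * x) * ‖evalReal f x‖) atTop (𝓝 0)}

/-- The field of fractions of a subalgebra `A` of `𝒪_k`, inside the field of meromorphic functions
on `Re z > k`. -/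
def quotientField {k : ℝ} (A : Subalgebra ℂ (Hol k)) : Subfield (Mer k) :=
  Subfield.closure (algebraMap (Hol k) (Mer k) '' (A : Set (Hol k)))

theorem mem_quotientField {k : ℝ} (A : Subalgebra ℂ (Hol k)) (x : Mer k) :
    x ∈ quotientField A ↔ ∃ a ∈ A, ∃ b ∈ A,
      algebraMap (Hol k) (Mer k) a / algebraMap (Hol k) (Mer k) b
        = x := by
  have h : Subring.closure (algebraMap (Hol k) (Mer k) '' (A : Set (Hol k)))
      = A.toSubring.map (algebraMap (Hol k) (Mer k)) := by
    rw [← RingHom.map_closure]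
    congr 1
    exact Subring.closure_eq A.toSubring
  rw [quotientField, Subfield.mem_closure_iff, h]
  simp

/-- The `ℂ`-algebra of entire functions. -/
def Entire : Subalgebra ℂ (ℂ → ℂ) where
  carrier := {f | Differentiable ℂ f}
  mul_mem' := fun h₁ h₂ => h₁.mul h₂
  add_mem' := fun h₁ h₂ => h₁.add h₂
  algebraMap_mem' c := differentiable_const c

/-- Order of growth `≤ ρ`. -/
def HasGrowth (f : ℂ → ℂ) (ρ : ℝ) : Prop :=
  ∃ A B : ℝ, 0 < A ∧ 0 < B ∧ ∀ z : ℂ, ‖f z‖ ≤ A * Real.exp (B * ‖z‖ ^ ρ)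

/-- The order of growth of `f`, the infimum of the `ρ > 0` such that `f` has an order of growth
`≤ ρ` (it is `⊤` if there is no such `ρ`). -/
def growthOrder (f : ℂ → ℂ) : EReal :=
  sInf {x : EReal | ∃ ρ : ℝ, 0 < ρ ∧ HasGrowth f ρ ∧ x = ρ}

theorem growthOrder_lt_iff (f : ℂ → ℂ) (σ : ℝ) :
    growthOrder f < σ ↔ ∃ ρ : ℝ, 0 < ρ ∧ ρ < σ ∧ HasGrowth f ρ := by
  rw [growthOrder, sInf_lt_iff]
  constructor
  · rintro ⟨_, ⟨ρ, h0, hg, rfl⟩, hlt⟩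
    exact ⟨ρ, h0, by exact_mod_cast hlt, hg⟩
  · rintro ⟨ρ, h0, hlt, hg⟩
    exact ⟨ρ, ⟨ρ, h0, hg, rfl⟩, by exact_mod_cast hlt⟩

theorem HasGrowth.mono {f : ℂ → ℂ} {ρ σ : ℝ} (h : HasGrowth f ρ) (h0 : 0 < ρ) (hle : ρ ≤ σ) :
    HasGrowth f σ := by
  obtain ⟨A, B, hA, hB, h⟩ := h
  refine ⟨A * Real.exp B, B, by positivity, hB, fun z => (h z).trans ?_⟩
  rw [mul_assoc, ← Real.exp_add]
  gcongr
  have key : ‖z‖ ^ ρ ≤ 1 + ‖z‖ ^ σ := by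
    rcases le_total ‖z‖ 1 with hz | hz
    · have h1 := Real.rpow_le_one (norm_nonneg z) hz h0.le
      have h2 := Real.rpow_nonneg (norm_nonneg z) σ
      linarith
    · have := Real.rpow_le_rpow_of_exponent_le hz hle
      linarith
  nlinarith

theorem HasGrowth.mul {f g : ℂ → ℂ} {ρ : ℝ} (hf : HasGrowth f ρ) (hg : HasGrowth g ρ) :
    HasGrowth (f * g) ρ := by
  obtain ⟨A, B, hA, hB, hf⟩ := hf
  obtain ⟨A', B', hA', hB', hg⟩ := hg
  refine ⟨A * A', B + B', by positivity, by positivity, fun z => ?_⟩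
  calc ‖(f * g) z‖ = ‖f z‖ * ‖g z‖ := by simp
    _ ≤ (A * Real.exp (B * ‖z‖ ^ ρ)) * (A' * Real.exp (B' * ‖z‖ ^ ρ)) := by
        gcongr
        · exact hf z
        · exact hg z
    _ = _ := by rw [add_mul, Real.exp_add]; ring

theorem HasGrowth.add {f g : ℂ → ℂ} {ρ : ℝ} (hf : HasGrowth f ρ) (hg : HasGrowth g ρ) :
    HasGrowth (f + g) ρ := by
  obtain ⟨A, B, hA, hB, hf⟩ := hf
  obtain ⟨A', B', hA', hB', hg⟩ := hg
  refine ⟨A + A', B + B', by positivity, by positivity, fun z => ?_⟩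
  have hr := Real.rpow_nonneg (norm_nonneg z) ρ
  calc ‖(f + g) z‖ ≤ ‖f z‖ + ‖g z‖ := norm_add_le _ _
    _ ≤ A * Real.exp (B * ‖z‖ ^ ρ) + A' * Real.exp (B' * ‖z‖ ^ ρ) := add_le_add (hf z) (hg z)
    _ ≤ A * Real.exp ((B + B') * ‖z‖ ^ ρ) + A' * Real.exp ((B + B') * ‖z‖ ^ ρ) := by
        gcongr <;> linarith
    _ = _ := by ring

/-- The algebra `𝒪_{<1}` of entire functions of order of growth `< 1`. -/
def entireOrderLTOne : Subalgebra ℂ Entire where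
  carrier := {f | growthOrder f.1 < (1 : ℝ)}
  mul_mem' := by
    rintro f g hf hg
    simp only [Set.mem_ofPred_eq, growthOrder_lt_iff] at hf hg ⊢
    obtain ⟨ρ, h0, h1, h⟩ := hf
    obtain ⟨ρ', h0', h1', h'⟩ := hg
    exact ⟨max ρ ρ', lt_max_of_lt_left h0, max_lt h1 h1',
      (h.mono h0 (le_max_left _ _)).mul (h'.mono h0' (le_max_right _ _))⟩
  add_mem' := by
    rintro f g hf hg
    simp only [Set.mem_ofPred_eq, growthOrder_lt_iff] at hf hg ⊢
    obtain ⟨ρ, h0, h1, h⟩ := hf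
    obtain ⟨ρ', h0', h1', h'⟩ := hg
    exact ⟨max ρ ρ', lt_max_of_lt_left h0, max_lt h1 h1',
      (h.mono h0 (le_max_left _ _)).add (h'.mono h0' (le_max_right _ _))⟩
  algebraMap_mem' c := by
    simp only [Set.mem_ofPred_eq, growthOrder_lt_iff]
    refine ⟨1 / 2, by norm_num, by norm_num, ‖c‖ + 1, 1, by positivity, one_pos, fun z => ?_⟩
    have h1 : (1 : ℝ) ≤ Real.exp (1 * ‖z‖ ^ (1 / 2 : ℝ)) := Real.one_le_exp (by positivity)
    have h2 : ‖(algebraMap ℂ Entire c).1 z‖ = ‖c‖ := rfl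
    rw [h2]
    nlinarith [norm_nonneg c]

/-- Restriction of entire functions to the half plane `Re z > k`. -/
def restrict (k : ℝ) : Entire →ₐ[ℂ] Hol k where
  toFun f := ⟨fun z => f.1 z, f.1, Differentiable.differentiableOn f.2, fun _ => rfl⟩
  map_one' := rfl
  map_mul' _ _ := rfl
  map_zero' := rfl
  map_add' _ _ := rfl
  commutes' _ := rfl

/-- The field of meromorphic functions of order `< 1`, that is, of the quotients of entire
functions of order `< 1`, viewed as meromorphic functions on `Re z > k`. -/
def meromorphicOrderLTOne (k : ℝ) : Subfield (Mer k) :=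
  quotientField (entireOrderLTOne.map (restrict k))

/-- `𝒟_k`: the arithmetic functions that are `O(n^{k+ε})` for every `ε > 0`. -/
def polyGrowth (k : ℝ) : Set (ArithmeticFunction ℂ) :=
  {α | ∀ ε : ℝ, 0 < ε → ∃ C : ℝ, 0 < C ∧ ∀ n : ℕ, 1 ≤ n → ‖α n‖ ≤ C * (n : ℝ) ^ (k + ε)}

/-- Equivalence of (multiplicative) arithmetic functions: for all but finitely many primes `p`,
they agree at all powers `p ^ j`, `j ≥ 1`. -/
def Equivalent (α β : ArithmeticFunction ℂ) : Prop :=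
  {p : ℕ | p.Prime ∧ ∃ j : ℕ, 1 ≤ j ∧ α (p ^ j) ≠ β (p ^ j)}.Finite

theorem abscissa_le {k : ℝ} {α : ArithmeticFunction ℂ} (hα : α ∈ polyGrowth k) :
    LSeries.abscissaOfAbsConv α ≤ ((k + 1 : ℝ) : EReal) := by
  refine EReal.le_of_forall_lt_iff_le.mp fun y hy => ?_
  have hy' : k + 1 < y := by exact_mod_cast hy
  obtain ⟨C, _, hC⟩ := hα (y - (k + 1)) (by linarith)
  have := LSeries.abscissaOfAbsConv_le_of_le_const_mul_rpow (f := α) (x := k + (y - (k + 1)))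
    ⟨C, fun n hn => hC n (Nat.one_le_iff_ne_zero.mpr hn)⟩
  refine this.trans (le_of_eq ?_)
  norm_cast
  ring

/-- The `i`-th derivative `F^{(i)}(α)` of the Dirichlet series `F(α)(z) = ∑ α(n) n^{-z}` of
`α ∈ 𝒟_k`, as a holomorphic function on `Re z > k + 1`. -/
def dirichletDeriv {k : ℝ} (α : ArithmeticFunction ℂ) (hα : α ∈ polyGrowth k) (i : ℕ) :
    Hol (k + 1) :=
  ⟨fun z => iteratedDeriv i (LSeries α) z, iteratedDeriv i (LSeries α), by
    have hA := LSeries_analyticOnNhd (α : ℕ → ℂ)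
    intro z hz
    have hz' : LSeries.abscissaOfAbsConv α < z.re :=
      (abscissa_le hα).trans_lt (by exact_mod_cast hz)
    rw [iteratedDeriv_eq_iterate]
    exact ((hA.iterated_deriv i) z hz').differentiableAt.differentiableWithinAt,
    fun _ => rfl⟩

end DirichletIndep

end

/-!
Multiplying `n` by a prime power `q` not dividing `n` turns `α(n) P(log n)` into
`α(q) α(n) P(log n + log q)`. If `α(q) ≠ β(q)`, subtracting `β(q)` times the original function
lowers the degree of the polynomial attached to `β` and preserves the degree of the one attached
to `α`; as `e`, `α₁, …, α_r` are pairwise non-equivalent, induction on degrees shows that the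
functions `α_j(n) (log n)^i` are linearly independent over `ℂ`.

In a relation `∑ a_{ij} F^{(i)}(α_j) = 0` with `a_{ij}` in `A`, let `n` be the first index at which
the combination `b = ∑ a_{ij} α_j(n) (-log n)^i` is nonzero. On the real axis `b(x)` is
`n^x` times a tail of size `o(e^{δx}) (n + 1)^{-x}`, so `b` is in `A` and decays exponentially,
which is excluded. Hence all these combinations vanish, and so do all `a_{ij}` by linear
independence of the coefficients.

For functions `f` of order `ρ < 1`, exponential decay on the positive axis forces `f = 0`: after a
rotation and multiplication by `exp (-K (1 + ζ)^ρ)` the function is bounded on a half plane and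
decays exponentially along one of the two boundary rays. That decay pays for multiplication by
`exp (-c ζ log (1 + ζ) - i c π ζ / 2)`, which adds superexponential decay on the inner normal, and
Phragmén–Lindelöf applies.
-/

noncomputable section

namespace DirichletIndep

section LogPolynomials

open Polynomial

/-- The operator on polynomials induced by dilation: if `α` and `L` turn a product of coprime
integers into a product and a sum, respectively, then `f n = α n * P (L n)` satisfies
`f (q * n) - b * f n = α n * P' (L n)`, where `P' = shiftDifference (α q) b (L q) P`. -/
def shiftDifference {R : Type*} [CommRing R] (a b t : R) : R[X] →ₗ[R] R[X] :=
  a • taylor t - b • LinearMap.id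

variable {R : Type*} [CommRing R]

theorem eval_shiftDifference (a b t x : R) (P : R[X]) :
    (shiftDifference a b t P).eval x = a * P.eval (x + t) - b * P.eval x := by
  simp [shiftDifference, taylor_eval]

theorem degree_shiftDifference_self_lt (a t : R) {P : R[X]} (hP : P ≠ 0) :
    (shiftDifference a a t P).degree < P.degree :=
  calc (shiftDifference a a t P).degree
      = (a • (taylor t P - P)).degree := by simp [shiftDifference, smul_sub]
    _ ≤ (taylor t P - P).degree := degree_smul_le _ _
    _ < P.degree := degree_sub_lt_right (degree_taylor P t) hP (leadingCoeff_taylor t P)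

theorem eq_zero_of_shiftDifference_eq_zero [IsDomain R] {a b : R} (hab : a ≠ b) {t : R} {P : R[X]}
    (h : shiftDifference a b t P = 0) : P = 0 := by
  have hlead : (a - b) * P.leadingCoeff = 0 := by
    simpa [shiftDifference, coeff_taylor_natDegree, sub_mul] using
      congrArg (coeff · P.natDegree) h
  exact leadingCoeff_eq_zero.1 ((mul_eq_zero.1 hlead).resolve_left (sub_ne_zero.2 hab))

theorem infinite_setOf_prime_not_dvd {α β : ArithmeticFunction ℂ} (h : ¬ Equivalent α β) {N : ℕ}
    (hN : N ≠ 0) :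
    {p : ℕ | p.Prime ∧ ¬ p ∣ N ∧ ∃ j : ℕ, 1 ≤ j ∧ α (p ^ j) ≠ β (p ^ j)}.Infinite := by
  intro hfin
  refine h ((hfin.union N.divisors.finite_toSet).subset fun p ⟨hp, hj⟩ ↦ ?_)
  by_cases hd : p ∣ N
  · exact Or.inr (by simpa using ⟨hd, hN⟩)
  · exact Or.inl ⟨hp, hd, hj⟩

theorem infinite_setOf_coprime_apply_ne_zero {α : ArithmeticFunction ℂ} (h : ¬ Equivalent 1 α)
    {N : ℕ} (hN : N ≠ 0) : {n : ℕ | n.Coprime N ∧ α n ≠ 0}.Infinite := by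
  refine Set.Infinite.of_image Nat.minFac ((infinite_setOf_prime_not_dvd h hN).mono ?_)
  rintro p ⟨hp, hpN, j, hj, hne⟩
  have hj0 : j ≠ 0 := Nat.one_le_iff_ne_zero.1 hj
  refine ⟨p ^ j, ⟨((hp.coprime_iff_not_dvd).2 hpN).pow_left j, ?_⟩, hp.pow_minFac hj0⟩
  rw [ArithmeticFunction.one_apply_ne (Nat.one_lt_pow hj0 hp.one_lt).ne'] at hne
  exact hne.symm

theorem log_natCast_mul {m n : ℕ} (hm : m ≠ 0) (hn : n ≠ 0) :
    Complex.log (m * n : ℕ) = Complex.log m + Complex.log n := by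
  simp only [← Complex.natCast_log]
  rw [Nat.cast_mul, Real.log_mul (by exact_mod_cast hm) (by exact_mod_cast hn), Complex.ofReal_add]

theorem injOn_log_natCast : Set.InjOn (fun n : ℕ ↦ Complex.log n) {n | n ≠ 0} := by
  intro m hm n hn hmn
  have hexp : Complex.exp (Complex.log m) = Complex.exp (Complex.log n) := congrArg _ hmn
  rw [Complex.exp_log (Nat.cast_ne_zero.2 hm), Complex.exp_log (Nat.cast_ne_zero.2 hn)] at hexp
  exact_mod_cast hexp

theorem eq_zero_of_mul_eval_neg_log_eq_zero {α : ArithmeticFunction ℂ} (hne : ¬ Equivalent 1 α)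
    {N : ℕ} (hN : N ≠ 0) {P : ℂ[X]}
    (h : ∀ n : ℕ, n ≠ 0 → n.Coprime N → α n * P.eval (-Complex.log n) = 0) : P = 0 := by
  have hn0 : ∀ n, α n ≠ 0 → n ≠ 0 := fun n hn h0 ↦ hn (by rw [h0, α.map_zero])
  have hinj : Set.InjOn (fun n : ℕ ↦ -Complex.log n) {n | n.Coprime N ∧ α n ≠ 0} :=
    fun m hm n hn hmn ↦ injOn_log_natCast (hn0 m hm.2) (hn0 n hn.2) (neg_injective hmn)
  refine P.eq_zero_of_infinite_isRoot
    (((infinite_setOf_coprime_apply_ne_zero hne hN).image hinj).mono ?_)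
  rintro _ ⟨n, ⟨hcop, hαn⟩, rfl⟩
  exact (mul_eq_zero.1 (h n (hn0 n hαn) hcop)).resolve_left hαn

variable {ι : Type*} {α : ι → ArithmeticFunction ℂ}

theorem sum_mul_eval_shiftDifference_eq_zero (hmul : ∀ j, (α j).IsMultiplicative) {s : Finset ι}
    {N q : ℕ} (hq : q ≠ 0) (hqN : q.Coprime N) {P : ι → ℂ[X]}
    (h : ∀ n : ℕ, n ≠ 0 → n.Coprime N → ∑ j ∈ s, α j n * (P j).eval (-Complex.log n) = 0)
    (b : ℂ) {n : ℕ} (hn : n ≠ 0) (hcop : n.Coprime (N * q)) :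
    ∑ j ∈ s, α j n * (shiftDifference (α j q) b (-Complex.log q) (P j)).eval (-Complex.log n)
      = 0 := by
  have hnN : n.Coprime N := hcop.coprime_mul_right_right
  have hqn : q.Coprime n := hcop.coprime_mul_left_right.symm
  have hlog : -Complex.log n + -Complex.log q = -Complex.log (q * n : ℕ) := by
    rw [log_natCast_mul hq hn]
    ring
  calc ∑ j ∈ s, α j n * (shiftDifference (α j q) b (-Complex.log q) (P j)).eval (-Complex.log n)
      = ∑ j ∈ s, α j (q * n) * (P j).eval (-Complex.log (q * n : ℕ))
          - b * ∑ j ∈ s, α j n * (P j).eval (-Complex.log n) := by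
        rw [Finset.mul_sum, ← Finset.sum_sub_distrib]
        refine Finset.sum_congr rfl fun j _ ↦ ?_
        rw [eval_shiftDifference, (hmul j).map_mul_of_coprime hqn, hlog]
        ring
    _ = 0 := by rw [h _ (mul_ne_zero hq hn) (hqN.mul_left hnN), h n hn hnN, mul_zero, sub_zero]

theorem eq_zero_of_sum_mul_eval_neg_log_eq_zero (hmul : ∀ j, (α j).IsMultiplicative)
    (hne : ∀ j, ¬ Equivalent 1 (α j)) (hpair : Pairwise fun i j ↦ ¬ Equivalent (α i) (α j))
    (s : Finset ι) {N : ℕ} (hN : N ≠ 0) (P : ι → ℂ[X])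
    (h : ∀ n : ℕ, n ≠ 0 → n.Coprime N → ∑ j ∈ s, α j n * (P j).eval (-Complex.log n) = 0) :
    ∀ j ∈ s, P j = 0 := by
  classical
  induction s using Finset.induction_on generalizing N P with
  | empty => simp
  | insert i s his ih =>
  induction hd : (P i).degree using WellFoundedLT.induction generalizing N P with
  | ind d ih_degree =>
  subst hd
  by_cases hi : P i = 0
  · refine (Finset.forall_mem_insert _ _ _).2 ⟨hi, ih hN P fun n hn hcop ↦ ?_⟩
    simpa [Finset.sum_insert his, hi] using h n hn hcop
  -- The dilation by `q` below lowers the degree of `P i` and does not annihilate `P j`.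
  have hs : ∀ j ∈ s, P j = 0 := by
    intro j hj
    have hij : i ≠ j := fun hij ↦ his (hij ▸ hj)
    obtain ⟨p, hp, hpN, e, -, hpe⟩ := (infinite_setOf_prime_not_dvd (hpair hij) hN).nonempty
    have hq : p ^ e ≠ 0 := pow_ne_zero e hp.ne_zero
    have hqN : (p ^ e).Coprime N := (hp.coprime_iff_not_dvd.2 hpN).pow_left e
    refine eq_zero_of_shiftDifference_eq_zero hpe.symm (ih_degree _
      (degree_shiftDifference_self_lt (α i (p ^ e)) (-Complex.log (p ^ e : ℕ)) hi)
      (mul_ne_zero hN hq)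
      (fun l ↦ shiftDifference (α l (p ^ e)) (α i (p ^ e)) (-Complex.log (p ^ e : ℕ)) (P l))
      (fun n hn hcop ↦ sum_mul_eval_shiftDifference_eq_zero hmul hq hqN h _ hn hcop) rfl j
      (Finset.mem_insert_of_mem hj))
  refine absurd (eq_zero_of_mul_eval_neg_log_eq_zero (hne i) hN fun n hn hcop ↦ ?_) hi
  have hrest : ∑ j ∈ s, α j n * (P j).eval (-Complex.log n) = 0 :=
    Finset.sum_eq_zero fun j hj ↦ by rw [hs j hj, eval_zero, mul_zero]
  have hsum := h n hn hcop
  rwa [Finset.sum_insert his, hrest, add_zero] at hsum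

/-- The coefficients of the `i`-th derivative of the Dirichlet series `∑ f n * n ^ (-z)`. -/
def derivCoeff (f : ℕ → ℂ) (i n : ℕ) : ℂ := f n * (-Complex.log n) ^ i

theorem linearIndependent_derivCoeff (hmul : ∀ j, (α j).IsMultiplicative)
    (hne : ∀ j, ¬ Equivalent 1 (α j)) (hpair : Pairwise fun i j ↦ ¬ Equivalent (α i) (α j)) :
    LinearIndependent ℂ fun ji : ι × ℕ ↦ derivCoeff (α ji.1) ji.2 := by
  classical
  rw [linearIndependent_iff']
  intro s g hg
  let P : ι → ℂ[X] := fun j ↦ ∑ ji ∈ s with ji.1 = j, monomial ji.2 (g ji)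
  have hP : ∀ j ∈ s.image Prod.fst, P j = 0 := by
    refine eq_zero_of_sum_mul_eval_neg_log_eq_zero hmul hne hpair _ one_ne_zero P
      fun n _ _ ↦ ?_
    calc ∑ j ∈ s.image Prod.fst, α j n * (P j).eval (-Complex.log n)
        = ∑ j ∈ s.image Prod.fst, ∑ ji ∈ s with ji.1 = j, g ji * derivCoeff (α ji.1) ji.2 n := by
          refine Finset.sum_congr rfl fun j _ ↦ ?_
          rw [eval_finsetSum, Finset.mul_sum]
          refine Finset.sum_congr rfl fun ji hji ↦ ?_
          rw [eval_monomial, derivCoeff, (Finset.mem_filter.1 hji).2]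
          ring
      _ = ∑ ji ∈ s, g ji * derivCoeff (α ji.1) ji.2 n :=
          Finset.sum_fiberwise_of_maps_to (fun _ ↦ Finset.mem_image_of_mem _) _
      _ = 0 := by simpa using congrFun hg n
  rintro ⟨j, i⟩ hji
  have hcoeff : (P j).coeff i = g (j, i) := by
    rw [finsetSum_coeff, Finset.sum_eq_single_of_mem (j, i) (by simpa using hji)]
    · simp
    · rintro ⟨j', i'⟩ hmem hne'
      obtain rfl : j' = j := (Finset.mem_filter.1 hmem).2
      exact coeff_monomial_of_ne _ fun hi ↦ hne' (by rw [hi])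
  rw [← hcoeff, hP j (Finset.mem_image_of_mem Prod.fst hji), coeff_zero]

end LogPolynomials

section QuotientField

variable {k : ℝ} (A : Subalgebra ℂ (Hol k))

instance quotientField.instAlgebra : Algebra A (quotientField A) :=
  (((algebraMap (Hol k) (Mer k)).comp A.val.toRingHom).codRestrict (quotientField A)
    fun a ↦ Subfield.subset_closure ⟨a, a.2, rfl⟩).toAlgebra

instance quotientField.instIsScalarTower : IsScalarTower A (quotientField A) (Mer k) :=
  .of_algebraMap_eq fun _ ↦ rfl

instance quotientField.instIsFractionRing : IsFractionRing A (quotientField A) := by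
  have hinj : Function.Injective (algebraMap A (quotientField A)) := by
    intro a b hab
    have := IsFractionRing.injective (Hol k) (Mer k) (congrArg Subtype.val hab)
    exact Subtype.ext this
  have : FaithfulSMul A (quotientField A) := (faithfulSMul_iff_algebraMap_injective _ _).2 hinj
  refine .of_field A _ fun x ↦ ?_
  obtain ⟨a, ha, b, hb, hab⟩ := (mem_quotientField A x).1 x.2
  exact ⟨⟨a, ha⟩, ⟨b, hb⟩, Subtype.ext hab.symm⟩

theorem linearIndependent_quotientField_iff {ι : Type*} {v : ι → Hol k} :
    LinearIndependent (quotientField A) (fun i ↦ algebraMap (Hol k) (Mer k) (v i)) ↔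
      LinearIndependent A v := by
  rw [← LinearIndependent.iff_fractionRing A (quotientField A)]
  let φ : Hol k →ₗ[A] Mer k := (IsScalarTower.toAlgHom A (Hol k) (Mer k)).toLinearMap
  exact φ.linearIndependent_iff_of_injOn (IsFractionRing.injective (Hol k) (Mer k)).injOn

end QuotientField

section DirichletSeries

open Asymptotics Finset

theorem isBigO_LSeries_of_forall_le_eq_zero {c : ℕ → ℂ} {n : ℕ} (h : ∀ m ≤ n, c m = 0)
    (hc : LSeries.abscissaOfAbsConv c < ⊤) :
    (fun x : ℝ ↦ LSeries c x) =O[atTop] fun x ↦ Real.exp (-Real.log (n + 1) * x) := by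
  have hpow : ∀ x : ℝ, ‖((n : ℂ) + 1) ^ (x : ℂ)‖ = Real.exp (Real.log (n + 1) * x) := fun x ↦ by
    rw [← Nat.cast_add_one, Complex.norm_natCast_cpow_of_pos n.succ_pos, Complex.ofReal_re,
      Real.rpow_def_of_pos (by positivity), Nat.cast_add_one]
  have hexp : (fun x : ℝ ↦ Real.exp (-Real.log (n + 1) * x)) =O[atTop]
      fun x ↦ Real.exp (-Real.log (n + 1) * x) := isBigO_refl _ _
  refine .of_norm_left <| (hexp.mul
    ((LSeries.tendsto_cpow_mul_atTop h hc).isBigO_one ℝ).norm_left).congr (fun x ↦ ?_)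
    fun x ↦ mul_one _
  rw [norm_mul, hpow, ← mul_assoc, ← Real.exp_add, neg_mul, neg_add_cancel, Real.exp_zero, one_mul]

theorem LSeries_ite_le_eq_sub {c : ℕ → ℂ} {s : ℂ} (hc : LSeriesSummable c s) (n : ℕ) :
    LSeries (fun m ↦ if m ≤ n then 0 else c m) s =
      LSeries c s - ∑ m ∈ range (n + 1), LSeries.term c s m := by
  let t : ℕ → ℂ := fun m ↦ if m ≤ n then 0 else c m
  have ht : LSeriesSummable t s :=
    hc.congr' s <| (eventually_gt_atTop n).mono fun m hm ↦ (if_neg hm.not_ge).symm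
  have hhead : LSeries (c - t) s = ∑ m ∈ range (n + 1), LSeries.term c s m := by
    refine (tsum_eq_sum fun m hm ↦ ?_).trans (sum_congr rfl fun m hm ↦ ?_)
    all_goals rw [mem_range_succ_iff] at hm; simp [LSeries.term_def, t, hm]
  rw [← hhead, LSeries_sub hc ht, sub_sub_cancel]

theorem isBigO_LSeries_sub_sum_range {c : ℕ → ℂ} (hc : LSeries.abscissaOfAbsConv c < ⊤) (n : ℕ) :
    (fun x : ℝ ↦ LSeries c x - ∑ m ∈ range (n + 1), LSeries.term c x m) =O[atTop]
      fun x ↦ Real.exp (-Real.log (n + 1) * x) := by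
  let t : ℕ → ℂ := fun m ↦ if m ≤ n then 0 else c m
  have ht : LSeries.abscissaOfAbsConv t = LSeries.abscissaOfAbsConv c :=
    LSeries.abscissaOfAbsConv_congr' <| (eventually_gt_atTop n).mono fun m hm ↦ if_neg hm.not_ge
  obtain ⟨y, hcy, -⟩ := EReal.lt_iff_exists_real_btwn.1 hc
  refine (isBigO_LSeries_of_forall_le_eq_zero (c := t) (fun m hm ↦ if_pos hm)
    (ht.trans_lt hc)).congr' ?_ EventuallyEq.rfl
  filter_upwards [eventually_ge_atTop y] with x hx
  exact LSeries_ite_le_eq_sub (LSeriesSummable_of_abscissaOfAbsConv_lt_re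
    (hcy.trans_le (by exact_mod_cast hx))) n

variable {k : ℝ}

/-- Evaluation at a point of the half plane `Re z > k`, as a homomorphism of algebras. -/
def evalAlgHom (z : HalfPlane k) : Hol k →ₐ[ℂ] ℂ :=
  (Pi.evalAlgHom ℂ (fun _ : HalfPlane k ↦ ℂ) z).comp (Hol k).val

theorem isLittleO_exp_iff {X : Type*} {l : Filter X} {f : X → ℂ} {g : X → ℝ} :
    f =o[l] (fun x ↦ Real.exp (g x)) ↔ Tendsto (fun x ↦ Real.exp (-g x) * ‖f x‖) l (𝓝 0) := by
  rw [← isLittleO_norm_left, isLittleO_iff_tendsto fun x hx ↦ absurd hx (Real.exp_ne_zero _)]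
  simp only [Real.exp_neg, div_eq_inv_mul]

theorem mem_subexp_iff {f : Hol k} :
    f ∈ subexp k ↔ ∀ a : ℝ, 0 < a → evalReal f =o[atTop] fun x : Set.Ioi k ↦ Real.exp (a * x) := by
  simp only [subexp, Set.mem_ofPred_eq, isLittleO_exp_iff, neg_mul]

theorem mem_expDecay_iff {f : Hol k} :
    f ∈ expDecay k ↔
      ∃ a : ℝ, 0 < a ∧ evalReal f =o[atTop] fun x : Set.Ioi k ↦ Real.exp (-a * x) := by
  simp only [expDecay, Set.mem_ofPred_eq, isLittleO_exp_iff, neg_mul, neg_neg]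

variable {ι : Type*}

theorem sum_evalReal_mul_term (s : Finset ι) (a : ι → Hol k) (c : ι → ℕ → ℂ) (x : Set.Ioi k)
    (m : ℕ) :
    ∑ i ∈ s, evalReal (a i) x * LSeries.term (c i) (x : ℝ) m =
      evalReal (∑ i ∈ s, c i m • a i) x * LSeries.term 1 (x : ℝ) m := by
  have hsum : evalReal (∑ i ∈ s, c i m • a i) x = ∑ i ∈ s, c i m * evalReal (a i) x := by
    change evalAlgHom ⟨((x : ℝ) : ℂ), x.2⟩ _ = _
    rw [map_sum]
    exact sum_congr rfl fun i _ ↦ map_smul _ _ _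
  rw [hsum, sum_mul]
  refine sum_congr rfl fun i _ ↦ ?_
  rcases eq_or_ne m 0 with rfl | hm
  · simp
  · simp only [LSeries.term_of_ne_zero hm, Pi.one_apply]
    ring

theorem tendsto_coe_Ioi_atTop : Tendsto ((↑) : Set.Ioi k → ℝ) atTop atTop :=
  tendsto_Ioi_atTop.1 tendsto_id

theorem evalReal_sum_smul_eq_neg_cpow_mul {s : Finset ι} {a : ι → Hol k} {c : ι → ℕ → ℂ}
    {x : Set.Ioi k} (h : ∑ i ∈ s, evalReal (a i) x * LSeries (c i) (x : ℝ) = 0) {n : ℕ}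
    (hn : n ≠ 0) (hlt : ∀ m < n, ∑ i ∈ s, c i m • a i = 0) :
    evalReal (∑ i ∈ s, c i n • a i) x = -((n : ℂ) ^ ((x : ℝ) : ℂ) * ∑ i ∈ s, evalReal (a i) x *
      (LSeries (c i) (x : ℝ) - ∑ m ∈ range (n + 1), LSeries.term (c i) (x : ℝ) m)) := by
  have hpow : (n : ℂ) ^ ((x : ℝ) : ℂ) ≠ 0 := by simp [Complex.cpow_eq_zero_iff, hn]
  have hhead : ∑ i ∈ s, evalReal (a i) x * ∑ m ∈ range (n + 1), LSeries.term (c i) (x : ℝ) m =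
      evalReal (∑ i ∈ s, c i n • a i) x / (n : ℂ) ^ ((x : ℝ) : ℂ) := by
    simp only [mul_sum]
    rw [sum_comm, sum_range_succ, sum_evalReal_mul_term, LSeries.term_of_ne_zero hn,
      sum_eq_zero fun m hm ↦ ?_, zero_add, Pi.one_apply, mul_one_div]
    rw [sum_evalReal_mul_term, hlt m (mem_range.1 hm)]
    exact zero_mul _
  simp only [mul_sub, sum_sub_distrib, h, hhead]
  field_simp
  ring

theorem sum_smul_mem_expDecay {s : Finset ι} {a : ι → Hol k} (ha : ∀ i ∈ s, a i ∈ subexp k)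
    {c : ι → ℕ → ℂ} (hc : ∀ i ∈ s, LSeries.abscissaOfAbsConv (c i) < ⊤)
    (h : ∀ᶠ x : Set.Ioi k in atTop, ∑ i ∈ s, evalReal (a i) x * LSeries (c i) (x : ℝ) = 0)
    {n : ℕ} (hn : n ≠ 0) (hlt : ∀ m < n, ∑ i ∈ s, c i m • a i = 0) :
    ∑ i ∈ s, c i n • a i ∈ expDecay k := by
  have hn' : (0 : ℝ) < n := by positivity
  let δ : ℝ := (Real.log (n + 1) - Real.log n) / 2
  have hδ : 0 < δ := half_pos (sub_pos.2 (Real.log_lt_log hn' (lt_add_one _)))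
  have htail : (fun x : Set.Ioi k ↦ ∑ i ∈ s, evalReal (a i) x *
      (LSeries (c i) (x : ℝ) - ∑ m ∈ range (n + 1), LSeries.term (c i) (x : ℝ) m))
      =o[atTop] fun x ↦ Real.exp (δ * x) * Real.exp (-Real.log (n + 1) * x) :=
    .fun_sum fun i hi ↦ (mem_subexp_iff.1 (ha i hi) δ hδ).mul_isBigO
      ((isBigO_LSeries_sub_sum_range (hc i hi) n).comp_tendsto tendsto_coe_Ioi_atTop)
  have hpow : (fun x : Set.Ioi k ↦ (n : ℂ) ^ ((x : ℝ) : ℂ)) =O[atTop]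
      fun x ↦ Real.exp (Real.log n * x) := .of_norm_le fun x ↦ by
    rw [Complex.norm_natCast_cpow_of_pos (Nat.pos_of_ne_zero hn), Complex.ofReal_re,
      Real.rpow_def_of_pos hn']
  refine mem_expDecay_iff.2 ⟨δ, hδ, (hpow.mul_isLittleO htail).neg_left.congr' ?_ ?_⟩
  · exact h.mono fun x hx ↦ (evalReal_sum_smul_eq_neg_cpow_mul hx hn hlt).symm
  · refine .of_forall fun x ↦ ?_
    simp only [← Real.exp_add, δ]
    ring_nf

theorem sum_smul_eq_zero_of_sum_mul_LSeries_eq_zero {A : Subalgebra ℂ (Hol k)}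
    (hA : (A : Set (Hol k)) ⊆ (subexp k \ expDecay k) ∪ {0}) {s : Finset ι} {a : ι → A}
    {c : ι → ℕ → ℂ} (hc0 : ∀ i, c i 0 = 0)
    (hc : ∀ i, LSeries.abscissaOfAbsConv (c i) < ⊤)
    (h : ∀ᶠ x : Set.Ioi k in atTop,
      ∑ i ∈ s, evalReal (a i : Hol k) x * LSeries (c i) (x : ℝ) = 0) (n : ℕ) :
    ∑ i ∈ s, c i n • (a i : Hol k) = 0 := by
  have hsub : ∀ f ∈ A, f ∈ subexp k := fun f hf ↦ (hA hf).elim And.left fun h0 ↦ by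
    rw [Set.mem_singleton_iff.1 h0]
    intro b _
    simp [evalReal]
  induction n using Nat.strong_induction_on with
  | _ n ih =>
  rcases eq_or_ne n 0 with rfl | hn
  · simp [hc0]
  · exact (hA (A.sum_mem fun i _ ↦ A.smul_mem (a i).2 _)).resolve_left fun hmem ↦ hmem.2
      (sum_smul_mem_expDecay (fun i _ ↦ hsub _ (a i).2) (fun i _ ↦ hc i) h hn ih)

theorem linearIndependent_of_LSeries {A : Subalgebra ℂ (Hol k)}
    (hA : (A : Set (Hol k)) ⊆ (subexp k \ expDecay k) ∪ {0}) {c : ι → ℕ → ℂ}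
    (hc0 : ∀ i, c i 0 = 0) (hc : ∀ i, LSeries.abscissaOfAbsConv (c i) < ⊤)
    (hlin : LinearIndependent ℂ c) {v : ι → Hol k}
    (hv : ∀ i, ∀ᶠ x : Set.Ioi k in atTop, evalReal (v i) x = LSeries (c i) (x : ℝ)) :
    LinearIndependent A v := by
  refine (linearIndependent_iff' (R := A) (v := v)).2 fun s a ha i hi ↦ ?_
  have hsum := sum_smul_eq_zero_of_sum_mul_LSeries_eq_zero hA (s := s) (a := a) hc0 hc (by
    filter_upwards [(eventually_all_finset s).2 fun i _ ↦ hv i] with x hx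
    rw [← map_zero (evalAlgHom ⟨((x : ℝ) : ℂ), x.2⟩), ← ha, map_sum]
    refine sum_congr rfl fun i hi ↦ ?_
    rw [← hx i hi]
    exact (map_mul (evalAlgHom ⟨((x : ℝ) : ℂ), x.2⟩) _ _).symm)
  ext z
  refine linearIndependent_iff'.1 hlin s (fun i ↦ evalAlgHom z (a i)) (funext fun n ↦ ?_) i hi
  have hz := congrArg (evalAlgHom z) (hsum n)
  simpa [mul_comm] using hz

end DirichletSeries

theorem derivCoeff_eq_smul_iterate_logMul (f : ℕ → ℂ) (i : ℕ) :
    derivCoeff f i = (-1 : ℂ) ^ i • LSeries.logMul^[i] f := by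
  induction i with
  | zero => ext n; simp [derivCoeff]
  | succ i ih =>
    ext n
    have hn := congrFun ih n
    simp only [derivCoeff, Pi.smul_apply, smul_eq_mul] at hn ⊢
    rw [Function.iterate_succ_apply', LSeries.logMul, pow_succ, ← mul_assoc, hn]
    ring

theorem abscissaOfAbsConv_derivCoeff (f : ℕ → ℂ) (i : ℕ) :
    LSeries.abscissaOfAbsConv (derivCoeff f i) = LSeries.abscissaOfAbsConv f := by
  have hunit : (-1 : ℂ) ^ i ≠ 0 := pow_ne_zero i (by norm_num)
  simp only [derivCoeff_eq_smul_iterate_logMul, LSeries.abscissaOfAbsConv,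
    LSeriesSummable.smul_iff hunit]
  exact LSeries.absicssaOfAbsConv_logPowMul

theorem evalReal_dirichletDeriv {k : ℝ} {α : ArithmeticFunction ℂ} (hα : α ∈ polyGrowth k) (i : ℕ)
    (x : Set.Ioi (k + 1)) :
    evalReal (dirichletDeriv α hα i) x = LSeries (derivCoeff α i) (x : ℝ) := by
  have hx : LSeries.abscissaOfAbsConv α < ((x : ℝ) : ℂ).re :=
    (abscissa_le hα).trans_lt (by exact_mod_cast x.2)
  rw [derivCoeff_eq_smul_iterate_logMul, LSeries_smul, ← LSeries_iteratedDeriv i hx]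
  rfl

theorem linearIndependent_dirichletDeriv {k : ℝ} {ι : Type*} {α : ι → ArithmeticFunction ℂ}
    (hα : ∀ j, α j ∈ polyGrowth k) (hmul : ∀ j, (α j).IsMultiplicative)
    (hne : ∀ j, ¬ Equivalent 1 (α j)) (hpair : Pairwise fun i j ↦ ¬ Equivalent (α i) (α j))
    {A : Subalgebra ℂ (Hol (k + 1))}
    (hA : (A : Set (Hol (k + 1))) ⊆ (subexp (k + 1) \ expDecay (k + 1)) ∪ {0}) :
    LinearIndependent A fun ji : ι × ℕ ↦ dirichletDeriv (α ji.1) (hα ji.1) ji.2 := by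
  refine linearIndependent_of_LSeries hA
    (c := fun ji : ι × ℕ ↦ derivCoeff (α ji.1) ji.2) (fun ji ↦ by simp [derivCoeff])
    (fun ji ↦ ?_) (linearIndependent_derivCoeff hmul hne hpair)
    fun ji ↦ .of_forall (evalReal_dirichletDeriv (hα ji.1) ji.2)
  rw [abscissaOfAbsConv_derivCoeff]
  exact (abscissa_le (hα ji.1)).trans_lt (EReal.coe_lt_top _)

section OrderLTOne

open Asymptotics

/-- A multiplier on the right half plane which is bounded on the negative imaginary axis, has
exponential growth on the positive one and decays superexponentially on the positive real axis. -/
def logMultiplier (c : ℝ) (ζ : ℂ) : ℂ :=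
  Complex.exp (c * (-(ζ * Complex.log (1 + ζ)) - (Real.pi / 2 : ℝ) * Complex.I * ζ))

theorem one_add_mem_slitPlane {ζ : ℂ} (hζ : 0 ≤ ζ.re) : 1 + ζ ∈ Complex.slitPlane :=
  Or.inl (by rw [Complex.add_re, Complex.one_re]; linarith)

theorem diffContOnCl_re_pos_of_differentiableAt {E : Type*} [NormedAddCommGroup E]
    [NormedSpace ℂ E] {f : ℂ → E}
    (h : ∀ ζ : ℂ, 0 ≤ ζ.re → DifferentiableAt ℂ f ζ) : DiffContOnCl ℂ f {ζ | 0 < ζ.re} := by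
  refine DifferentiableOn.diffContOnCl fun ζ hζ ↦ (h ζ ?_).differentiableWithinAt
  rwa [Complex.closure_setOfPred_lt_re] at hζ

theorem differentiableAt_logMultiplier (c : ℝ) {ζ : ℂ} (hζ : 0 ≤ ζ.re) :
    DifferentiableAt ℂ (logMultiplier c) ζ := by
  have hlog : DifferentiableAt ℂ (fun ζ ↦ Complex.log (1 + ζ)) ζ :=
    (differentiableAt_id.const_add 1).clog (one_add_mem_slitPlane hζ)
  unfold logMultiplier
  fun_prop

theorem norm_logMultiplier_le {c : ℝ} (hc : 0 ≤ c) {ζ : ℂ} (hζ : 0 ≤ ζ.re) :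
    ‖logMultiplier c ζ‖ ≤
      Real.exp (c * (Real.pi * max ζ.im 0 - ζ.re * Real.log (1 + ζ.re))) := by
  have hre : (1 + ζ).re = 1 + ζ.re := by simp
  have harg := abs_le.1 (Complex.abs_arg_le_pi_div_two_iff.2 (show 0 ≤ (1 + ζ).re by linarith))
  have hlog : ζ.re * Real.log (1 + ζ.re) ≤ ζ.re * Real.log ‖1 + ζ‖ := by
    gcongr
    exact hre ▸ Complex.re_le_norm (1 + ζ)
  have him : ζ.im * ((1 + ζ).arg + Real.pi / 2) ≤ Real.pi * max ζ.im 0 := by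
    rcases le_total 0 ζ.im with h | h
    · rw [max_eq_left h]
      nlinarith
    · rw [max_eq_right h]
      nlinarith
  rw [logMultiplier, Complex.norm_exp, Real.exp_le_exp, Complex.re_ofReal_mul]
  gcongr
  simp only [Complex.sub_re, Complex.neg_re, Complex.mul_re, Complex.mul_im, Complex.log_re,
    Complex.log_im, Complex.I_re, Complex.I_im, Complex.ofReal_re, Complex.ofReal_im]
  linarith

theorem superpolynomialDecay_logMultiplier {c : ℝ} (hc : 0 < c) :
    SuperpolynomialDecay atTop Real.exp fun x : ℝ ↦ ‖logMultiplier c x‖ := by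
  intro n
  refine squeeze_zero' (.of_forall fun x ↦ by positivity) ?_ Real.tendsto_exp_neg_atTop_nhds_zero
  have hlog : ∀ᶠ x : ℝ in atTop, (n + 1) / c ≤ Real.log (1 + x) :=
    (Real.tendsto_log_atTop.comp
      (tendsto_atTop_add_const_left _ 1 tendsto_id)).eventually_ge_atTop _
  filter_upwards [hlog, eventually_ge_atTop 0] with x hx hx0
  have hle := norm_logMultiplier_le hc.le (ζ := x) (by simpa using hx0)
  rw [Complex.ofReal_im, Complex.ofReal_re, max_self, mul_zero, zero_sub] at hle
  rw [div_le_iff₀' hc] at hx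
  calc Real.exp x ^ n * ‖logMultiplier c x‖
      ≤ Real.exp (n * x) * Real.exp (c * -(x * Real.log (1 + x))) := by
        rw [← Real.exp_nat_mul]
        gcongr
    _ ≤ Real.exp (-x) := by
        rw [← Real.exp_add, Real.exp_le_exp]
        nlinarith

theorem exists_norm_mul_exp_le {E : Type*} [SeminormedAddCommGroup E] {u : ℝ → E} {M : ℝ}
    (hM : ∀ y, ‖u y‖ ≤ M) {a : ℝ} (ha : 0 ≤ a) (hu : u =O[atTop] fun y ↦ Real.exp (-a * y)) :
    ∃ C, ∀ y, ‖u y‖ * Real.exp (a * max y 0) ≤ C := by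
  obtain ⟨C, hC⟩ := hu.bound
  obtain ⟨y₁, hy₁⟩ := eventually_atTop.1 hC
  have hM0 : 0 ≤ M := (norm_nonneg _).trans (hM 0)
  refine ⟨max C (M * Real.exp (a * max y₁ 0)), fun y ↦ ?_⟩
  rcases le_total y (max y₁ 0) with hy | hy
  · refine le_max_of_le_right ?_
    gcongr ?_ * Real.exp (a * ?_)
    · exact hM y
    · exact max_le hy (le_max_right _ _)
  · rw [max_eq_left ((le_max_right _ _).trans hy)]
    refine le_max_of_le_left ?_
    have hle := hy₁ y ((le_max_left _ _).trans hy)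
    rwa [Real.norm_of_nonneg (Real.exp_pos _).le, neg_mul, Real.exp_neg, ← div_eq_mul_inv,
      le_div_iff₀ (Real.exp_pos _)] at hle

theorem norm_logMultiplier_div_pi_le {a : ℝ} (ha : 0 ≤ a) {ζ : ℂ} (hζ : 0 ≤ ζ.re) :
    ‖logMultiplier (a / Real.pi) ζ‖ ≤ Real.exp (a * max ζ.im 0) := by
  refine (norm_logMultiplier_le (by positivity) hζ).trans (Real.exp_le_exp.2 ?_)
  have hlog : 0 ≤ ζ.re * Real.log (1 + ζ.re) := mul_nonneg hζ (Real.log_nonneg (by linarith))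
  calc a / Real.pi * (Real.pi * max ζ.im 0 - ζ.re * Real.log (1 + ζ.re))
      ≤ a / Real.pi * (Real.pi * max ζ.im 0) := by
        gcongr
        linarith
    _ = a * max ζ.im 0 := by field_simp

theorem eqOn_zero_of_bounded_of_exp_decay {g : ℂ → ℂ} (hg : DiffContOnCl ℂ g {ζ | 0 < ζ.re})
    {M : ℝ} (hM : ∀ ζ : ℂ, 0 ≤ ζ.re → ‖g ζ‖ ≤ M) {a : ℝ} (ha : 0 < a)
    (hdecay : (fun y : ℝ ↦ g (y * Complex.I)) =O[atTop] fun y ↦ Real.exp (-a * y)) :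
    Set.EqOn g 0 {ζ | 0 ≤ ζ.re} := by
  let L := logMultiplier (a / Real.pi)
  have hL : DiffContOnCl ℂ L {ζ | 0 < ζ.re} :=
    diffContOnCl_re_pos_of_differentiableAt fun ζ ↦ differentiableAt_logMultiplier _
  have hM0 : 0 ≤ M := (norm_nonneg _).trans (hM 0 le_rfl)
  have hbound : ∀ ζ : ℂ, 0 ≤ ζ.re → ‖L ζ • g ζ‖ ≤ ‖g ζ‖ * Real.exp (a * max ζ.im 0) :=
    fun ζ hζ ↦ by
      rw [norm_smul, mul_comm]
      gcongr
      exact norm_logMultiplier_div_pi_le ha.le hζ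
  have hzero : Set.EqOn (fun ζ ↦ L ζ • g ζ) 0 {ζ | 0 ≤ ζ.re} := by
    refine PhragmenLindelof.eq_zero_on_right_half_plane_of_superexponential_decay (hL.smul hg)
      ⟨1, one_lt_two, a, .of_bound M ?_⟩ ?_ ?_
    · refine eventually_inf_principal.2 (.of_forall fun ζ hζ ↦ (hbound ζ (le_of_lt hζ)).trans ?_)
      rw [Real.norm_of_nonneg (Real.exp_pos _).le, Real.rpow_one]
      gcongr
      · exact hM ζ (le_of_lt hζ)
      · exact max_le ((le_abs_self _).trans (Complex.abs_im_le_norm ζ)) (norm_nonneg ζ)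
    · refine ((superpolynomialDecay_logMultiplier (div_pos ha Real.pi_pos)).const_mul
        M).trans_eventually_abs_le ?_
      filter_upwards [eventually_ge_atTop 0] with x hx
      simp only [Function.comp_apply, abs_mul, abs_norm, norm_smul, abs_of_nonneg hM0]
      rw [mul_comm]
      gcongr
      exact hM x hx
    · obtain ⟨C, hC⟩ := exists_norm_mul_exp_le (fun y ↦ hM (y * Complex.I) (by simp)) ha.le hdecay
      exact ⟨C, fun y ↦ (hbound _ (by simp)).trans (by simpa using hC y)⟩
  exact fun ζ hζ ↦ (smul_eq_zero.1 (hzero hζ)).resolve_left (Complex.exp_ne_zero _)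

theorem cos_mul_norm_rpow_le_re_cpow {ρ : ℝ} (h0 : 0 ≤ ρ) (h2 : ρ ≤ 2) {w : ℂ} (hw : w ≠ 0)
    (hre : 0 ≤ w.re) : Real.cos (ρ * (Real.pi / 2)) * ‖w‖ ^ ρ ≤ (w ^ (ρ : ℂ)).re := by
  have harg := Complex.abs_arg_le_pi_div_two_iff.2 hre
  rw [Complex.cpow_def_of_ne_zero hw, Complex.exp_re, Complex.re_mul_ofReal,
    Complex.im_mul_ofReal, Complex.log_re, Complex.log_im,
    ← Real.rpow_def_of_pos (norm_pos_iff.2 hw), mul_comm, ← Real.cos_abs (w.arg * ρ), abs_mul,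
    abs_of_nonneg h0, mul_comm _ ρ]
  gcongr
  exact Real.cos_le_cos_of_nonneg_of_le_pi (by positivity) (by nlinarith [Real.pi_pos])
    (by gcongr)

theorem norm_exp_neg_cpow_le {B ρ : ℝ} (hB : 0 ≤ B) (h0 : 0 ≤ ρ) (h1 : ρ < 1) {ζ : ℂ}
    (hζ : 0 ≤ ζ.re) :
    ‖Complex.exp (-((B / Real.cos (ρ * (Real.pi / 2)) : ℝ) * (1 + ζ) ^ (ρ : ℂ)))‖ ≤
      Real.exp (-(B * ‖ζ‖ ^ ρ)) := by
  have hcos : 0 < Real.cos (ρ * (Real.pi / 2)) :=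
    Real.cos_pos_of_mem_Ioo ⟨by nlinarith [Real.pi_pos], by nlinarith [Real.pi_pos]⟩
  have hre : 0 ≤ (1 + ζ).re := by
    rw [Complex.add_re, Complex.one_re]
    linarith
  have hnorm : ‖ζ‖ ≤ ‖1 + ζ‖ := by
    refine (sq_le_sq₀ (norm_nonneg _) (norm_nonneg _)).1 ?_
    rw [Complex.sq_norm, Complex.sq_norm, Complex.normSq_add]
    simp
    linarith
  rw [Complex.norm_exp, Real.exp_le_exp, Complex.neg_re, Complex.re_ofReal_mul, neg_le_neg_iff]
  calc B * ‖ζ‖ ^ ρ ≤ B * ‖1 + ζ‖ ^ ρ := by gcongr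
    _ = B / Real.cos (ρ * (Real.pi / 2)) * (Real.cos (ρ * (Real.pi / 2)) * ‖1 + ζ‖ ^ ρ) := by
      rw [← mul_assoc, div_mul_cancel₀ _ hcos.ne']
    _ ≤ B / Real.cos (ρ * (Real.pi / 2)) * ((1 + ζ) ^ (ρ : ℂ)).re := by
      gcongr
      exact cos_mul_norm_rpow_le_re_cpow h0 (by linarith)
        (Complex.slitPlane_ne_zero (one_add_mem_slitPlane hζ)) hre

theorem eq_zero_of_hasGrowth_of_exp_decay {f : ℂ → ℂ} (hf : Differentiable ℂ f) {ρ : ℝ}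
    (h0 : 0 ≤ ρ) (h1 : ρ < 1) (hg : HasGrowth f ρ) {a : ℝ} (ha : 0 < a)
    (hdecay : (fun x : ℝ ↦ f x) =O[atTop] fun x ↦ Real.exp (-a * x)) : f = 0 := by
  obtain ⟨A, B, -, hB, hAB⟩ := hg
  let E : ℂ → ℂ := fun ζ ↦
    Complex.exp (-((B / Real.cos (ρ * (Real.pi / 2)) : ℝ) * (1 + ζ) ^ (ρ : ℂ)))
  have hE : ∀ ζ : ℂ, 0 ≤ ζ.re → ‖E ζ‖ ≤ Real.exp (-(B * ‖ζ‖ ^ ρ)) :=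
    fun ζ ↦ norm_exp_neg_cpow_le hB.le h0 h1
  have hzero : Set.EqOn (fun ζ ↦ E ζ * f (-Complex.I * ζ)) 0 {ζ | 0 ≤ ζ.re} := by
    refine eqOn_zero_of_bounded_of_exp_decay (M := A)
      (diffContOnCl_re_pos_of_differentiableAt fun ζ hζ ↦ ?_) (fun ζ hζ ↦ ?_) ha ?_
    · have hpow : DifferentiableAt ℂ (fun ζ : ℂ ↦ (1 + ζ) ^ (ρ : ℂ)) ζ :=
        (differentiableAt_id.const_add 1).cpow_const (one_add_mem_slitPlane hζ)
      fun_prop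
    · calc ‖E ζ * f (-Complex.I * ζ)‖
          ≤ Real.exp (-(B * ‖ζ‖ ^ ρ)) * (A * Real.exp (B * ‖ζ‖ ^ ρ)) := by
            rw [norm_mul]
            gcongr
            · exact hE ζ hζ
            · simpa using hAB (-Complex.I * ζ)
        _ = A := by rw [mul_left_comm, ← Real.exp_add, neg_add_cancel, Real.exp_zero, mul_one]
    · refine (IsBigO.of_norm_le fun y ↦ ?_).trans hdecay.norm_left
      have hy : -Complex.I * (y * Complex.I) = y := by
        linear_combination -(y : ℂ) * Complex.I_mul_I
      rw [norm_mul, hy]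
      refine mul_le_of_le_one_left (norm_nonneg _) ((hE _ (by simp)).trans ?_)
      exact Real.exp_le_one_iff.2 (neg_nonpos.2 (by positivity))
  have hlower : ∀ᶠ z : ℂ in 𝓝 (-Complex.I), z.im < 0 :=
    Complex.continuous_im.continuousAt.eventually_lt_const (by simp)
  refine (Complex.analyticOnNhd_univ_iff_differentiable.2 hf).eq_of_eventuallyEq
    analyticOnNhd_const (z₀ := -Complex.I) (hlower.mono fun z hz ↦ ?_)
  have hmul : E (Complex.I * z) * f (-Complex.I * (Complex.I * z)) = 0 :=
    hzero (show 0 ≤ (Complex.I * z).re by simpa using hz.le)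
  rw [neg_mul, ← mul_assoc, Complex.I_mul_I, neg_one_mul, neg_neg] at hmul
  exact (mul_eq_zero.1 hmul).resolve_left (Complex.exp_ne_zero _)

theorem isLittleO_rpow_id_atTop {ρ : ℝ} (h1 : ρ < 1) :
    (fun x : ℝ ↦ x ^ ρ) =o[atTop] fun x ↦ x := by
  refine (isLittleO_iff_tendsto' ((eventually_ne_atTop 0).mono fun x hx h ↦ absurd h hx)).2 ?_
  refine (tendsto_rpow_neg_atTop (sub_pos.2 h1)).congr' ?_
  filter_upwards [eventually_ne_atTop 0] with x hx
  rw [neg_sub, Real.rpow_sub_one hx]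

theorem restrict_mem_subexp (k : ℝ) {f : Entire} (hf : f ∈ entireOrderLTOne) :
    restrict k f ∈ subexp k := by
  obtain ⟨ρ, -, h1, A, B, -, -, hAB⟩ := (growthOrder_lt_iff f.1 1).1 hf
  refine mem_subexp_iff.2 fun a ha ↦ ?_
  have hbound : (fun x : ℝ ↦ f.1 x) =O[atTop] fun x ↦ Real.exp (B * x ^ ρ) := by
    refine .of_bound A ((eventually_ge_atTop 0).mono fun x hx ↦ ?_)
    simpa [abs_of_nonneg hx] using hAB x
  have hexp : (fun x : ℝ ↦ Real.exp (B * x ^ ρ)) =o[atTop] fun x ↦ Real.exp (a * x) := by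
    have hlin : (fun x : ℝ ↦ B * x ^ ρ) =o[atTop] fun x ↦ a * x :=
      (isLittleO_rpow_id_atTop h1).const_mul_left B |>.const_mul_right ha.ne'
    exact Real.isLittleO_exp_comp_exp_comp.2
      ((IsEquivalent.refl.sub_isLittleO hlin).symm.tendsto_atTop (tendsto_id.const_mul_atTop ha))
  exact (hbound.trans_isLittleO hexp).comp_tendsto tendsto_coe_Ioi_atTop

theorem eq_zero_of_restrict_mem_expDecay {k : ℝ} {f : Entire} (hf : f ∈ entireOrderLTOne)
    (hdec : restrict k f ∈ expDecay k) : f = 0 := by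
  obtain ⟨ρ, h0, h1, hg⟩ := (growthOrder_lt_iff f.1 1).1 hf
  obtain ⟨a, ha, hlim⟩ := mem_expDecay_iff.1 hdec
  refine Subtype.ext (eq_zero_of_hasGrowth_of_exp_decay f.2 h0.le h1 hg ha ?_)
  rw [← map_val_Ioi_atTop k, isBigO_map]
  exact hlim.isBigO

theorem map_restrict_entireOrderLTOne_subset (k : ℝ) :
    (entireOrderLTOne.map (restrict k) : Set (Hol k)) ⊆ (subexp k \ expDecay k) ∪ {0} := by
  rintro _ ⟨f, hf, rfl⟩
  by_cases hdec : restrict k f ∈ expDecay k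
  · exact Or.inr (by rw [eq_zero_of_restrict_mem_expDecay hf hdec]; exact map_zero (restrict k))
  · exact Or.inl ⟨restrict_mem_subexp k hf, hdec⟩

end OrderLTOne

end DirichletIndep

end

open DirichletIndep in
theorem proposition3p2_general (k : ℝ) {ι : Type*} (α : ι → ArithmeticFunction ℂ)
    (hα : ∀ j, α j ∈ polyGrowth k) (hmul : ∀ j, (α j).IsMultiplicative)
    (hne : ∀ j, ¬ Equivalent 1 (α j)) (hpair : ∀ i j, i ≠ j → ¬ Equivalent (α i) (α j)) :
    (∀ A : Subalgebra ℂ (Hol (k + 1)),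
      (A : Set (Hol (k + 1))) ⊆ (subexp (k + 1) \ expDecay (k + 1)) ∪ {0} →
      LinearIndependent (quotientField A) fun ji : ι × ℕ ↦
        algebraMap (Hol (k + 1)) (Mer (k + 1)) (dirichletDeriv (α ji.1) (hα ji.1) ji.2)) ∧
    LinearIndependent (meromorphicOrderLTOne (k + 1)) fun ji : ι × ℕ ↦
      algebraMap (Hol (k + 1)) (Mer (k + 1)) (dirichletDeriv (α ji.1) (hα ji.1) ji.2) := by
  have hindep : ∀ A : Subalgebra ℂ (Hol (k + 1)),
      (A : Set (Hol (k + 1))) ⊆ (subexp (k + 1) \ expDecay (k + 1)) ∪ {0} →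
      LinearIndependent (quotientField A) fun ji : ι × ℕ ↦
        algebraMap (Hol (k + 1)) (Mer (k + 1)) (dirichletDeriv (α ji.1) (hα ji.1) ji.2) :=
    fun A hA ↦ (linearIndependent_quotientField_iff A).2
      (linearIndependent_dirichletDeriv hα hmul hne hpair hA)
  exact ⟨hindep, hindep _ (map_restrict_entireOrderLTOne_subset (k + 1))⟩

open DirichletIndep in
theorem proposition3p2 (k : ℝ) (r m : ℕ) (α : Fin r → ArithmeticFunction ℂ)
    (hα : ∀ j, α j ∈ polyGrowth k)
    (hmul : ∀ j, (α j).IsMultiplicative)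
    (hne : ∀ j, ¬ Equivalent 1 (α j))
    (hpair : ∀ i j, i ≠ j → ¬ Equivalent (α i) (α j)) :
    (∀ A : Subalgebra ℂ (Hol (k + 1)),
      (A : Set (Hol (k + 1))) ⊆ (subexp (k + 1) \ expDecay (k + 1)) ∪ {0} →
      LinearIndependent (quotientField A)
        (fun ji : Fin r × Fin (m + 1) =>
          algebraMap (Hol (k + 1)) (Mer (k + 1))
            (dirichletDeriv (α ji.1) (hα ji.1) ji.2))) ∧
    LinearIndependent (meromorphicOrderLTOne (k + 1))
      (fun ji : Fin r × Fin (m + 1) =>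
        algebraMap (Hol (k + 1)) (Mer (k + 1))
          (dirichletDeriv (α ji.1) (hα ji.1) ji.2)) := by
  let toNat : Fin r × Fin (m + 1) → Fin r × ℕ := Prod.map id Fin.val
  have htoNat : Function.Injective toNat := Function.injective_id.prodMap Fin.val_injective
  have hgen := proposition3p2_general k α hα hmul hne hpair
  exact ⟨fun A hA ↦ (hgen.1 A hA).comp toNat htoNat, hgen.2.comp toNat htoNat⟩
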